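/- Let $K$ be a finite simplicial complex embedded in $\mathbb R^{q+1}$ ($q\ge 0$), with arbitrarily oriented $q$-simplices ("edges") and with all $(q+1)$-simplices ("facets") oriented coherently with a fixed orientation of $\mathbb R^{q+1}$. A \emph{void} is a connected component of $\mathbb R^{q+1}\setminus|K|$ (the unbounded one included). Every oriented edge $e$ has one facet or void $\tau$ on its positive side and one, $\eta$, on its negative side, and we write $e=(\eta\rightharpoonup\tau)$; here a facet is on the positive (negative) side of $e$ iff $e$ occurs in its boundary with coefficient $+1$ ($-1$), and the sides of voids are fixed by the same convention. Let $R$ be $\mathbb Z$ (or any ordered commutative ring, e.g. $\mathbb R$); chains have coefficients in $R$. Let $c_e>0$ and $a_\tau\ge 0$ be weights of the edges and of the facets, $z\in Z_q(K;R)$ a $q$-cycle, $\mathcal S,\mathcal T$ finite sets of voids, and $\gamma_\nu\in R$. Consider the directed dual linear program, with variables $\pi$ on facets and voids, $\pi^{\pm}$ on facets, and $\vec x$ on both orientations $(\eta\rightharpoonup\tau)$, $(\tau\rightharpoonup\eta)$ of every edge: $$\min\ \sum_{\tau} a_\tau\pi^+_\tau+\sum_\tau a_\tau\pi^-_\tau+\sum_{\nu\in\mathcal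 T}\gamma_\nu\pi(\nu)-\sum_{\nu\in\mathcal S}\gamma_\nu\pi(\nu)+\sum_{e=(\eta\rightharpoonup\tau)}c_e\big(\vec x(\eta\rightharpoonup\tau)+\vec x(\tau\rightharpoonup\eta)\big)$$ subject to, for every edge $e=(\eta\rightharpoonup\tau)$, $$\pi(\eta)-\pi(\tau)+\vec x(\eta\rightharpoonup\tau)\ge -z(e),\qquad \pi(\tau)-\pi(\eta)+\vec x(\tau\rightharpoonup\eta)\ge z(e),$$ and $\vec x\ge 0$, $\pi^{\pm}\ge 0$, $\pi=\pi^+-\pi^-$ on facets, and $\pi(\nu)=0$ for every void $\nu$. All variables take values in $R$. Let $(\pi_\star,\vec x_\star)$ be an optimal solution. Then: (a) $\pi_\star(\nu)=0$ for every void $\nu$. (b) The $q$-chain $x_\star$ on $K$ defined by $x_\star(e)=\vec x_\star(\tau\rightharpoonup\eta)-\vec x_\star(\eta\rightharpoonup\tau)$ for $e=(\eta\rightharpoonup\tau)$ is a $q$-cycle homologous to $z$ on $K$ with $\partial_{q+1}\pi_\star=z-x_\star$, and it is minimal for the flat norm: for every $q$-cycle $x$ homologous to $z$ on $K$ and every $(q+1)$-chain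 $\pi$ with $\partial_{q+1}\pi=z-x$, $$\sum_e c_e|x_\star(e)|+\sum_\tau a_\tau|\pi_\star(\tau)|\ \le\ \sum_e c_e|x(e)|+\sum_\tau a_\tau|\pi(\tau)|.$$ In particular, if $a=0$, then $x_\star$ has the least cost $\sum_e c_e|x(e)|$ among all $q$-cycles $x$ homologous to $z$ on $K$ (optimal homologous cycle problem). -/

import Mathlib

noncomputable section

namespace FlatNorm

/-- Euclidean space of dimension `q + 1`. -/
abbrev Space (q : ℕ) : Type := EuclideanSpace ℝ (Fin (q + 1))

/-- The homogeneous determinant of `q + 2` points of `ℝ^(q+1)`: the determinant of the matrix with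
rows `(1, pᵢ)`. Its sign is the orientation of the simplex `[p₀, …, p_(q+1)]`. -/
def orientDet {q : ℕ} (p : Fin (q + 2) → Space q) : ℝ :=
  Matrix.det (Matrix.of fun i j : Fin (q + 2) =>
    (Fin.cons 1 (fun k => p i k) : Fin (q + 2) → ℝ) j)

/-- A finite simplicial complex `K` embedded in `ℝ^(q+1)`, with an orientation of each simplex.
The orientation of a simplex is recorded as a sign relative to the increasing order of its vertices
for an auxiliary linear order. It is arbitrary, except that the `(q+1)`-simplices are
all oriented like the ambient space, for one of its two orientations `ambient`. -/
structure OrientedComplex (q : ℕ) where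
  /-- the underlying geometric simplicial complex -/
  K : Geometry.SimplicialComplex ℝ (Space q)
  finite_faces : K.faces.Finite
  /-- the auxiliary order on vertices -/
  vord : LinearOrder (Space q)
  /-- the orientation of each simplex -/
  sgn : Finset (Space q) → ℤˣ
  /-- the orientation of the ambient space (`1` is the standard one) -/
  ambient : ℤˣ
  facet_oriented : ∀ s ∈ K.faces, ∀ h : s.card = q + 2,
    0 < (((ambient * sgn s : ℤˣ) : ℤ) : ℝ) * orientDet (@Finset.orderEmbOfFin _ vord s _ h)

namespace OrientedComplex

variable {q : ℕ} (O : OrientedComplex q)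

/-- The `k`-simplices of `K`. -/
def Simplex (k : ℕ) : Type := {s : Finset (Space q) // s ∈ O.K.faces ∧ s.card = k + 1}

/-- The `q`-simplices, called edge-simplices. -/
abbrev Edge : Type := O.Simplex q

/-- The `(q+1)`-simplices, called facet-simplices. -/
abbrev Facet : Type := O.Simplex (q + 1)

instance (k : ℕ) : Finite (O.Simplex k) :=
  (O.finite_faces.subset fun _ h => h.1 :
    {s : Finset (Space q) | s ∈ O.K.faces ∧ s.card = k + 1}.Finite).to_subtype

instance (k : ℕ) : Fintype (O.Simplex k) := Fintype.ofFinite _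

open Classical in
/-- The incidence number `[s : t]` of a `(k+1)`-simplex and a `k`-simplex: it is `0` unless `t` is
a face of `s`, and `sgn s * sgn t * (-1)^i` if `t` arises from `s` by removing its `i`-th vertex,
i.e. the vertex of `s` below which there are exactly `i` other vertices of `s`. -/
def incidence {k : ℕ} (s : O.Simplex (k + 1)) (t : O.Simplex k) : ℤ :=
  if t.1 ⊆ s.1 then
    ((O.sgn s.1 * O.sgn t.1 : ℤˣ) : ℤ) *
      (-1) ^ (s.1.filter fun u => ∃ v ∈ s.1, v ∉ t.1 ∧ O.vord.lt u v).card
  else 0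

/-- The `k`-chains of `K` with coefficients in `R`. -/
abbrev Chain (R : Type*) (k : ℕ) : Type _ := O.Simplex k → R

/-- The boundary operator `∂ : C_(k+1)(K; R) → C_k(K; R)`. -/
def boundary {R : Type*} [CommRing R] (k : ℕ) (y : O.Chain R (k + 1)) : O.Chain R k :=
  fun t => ∑ s, (O.incidence s t : R) * y s

/-- The `k`-cycles of `K` (every `0`-chain is a `0`-cycle). -/
def IsCycle {R : Type*} [CommRing R] : (k : ℕ) → O.Chain R k → Prop
  | 0, _ => True
  | k + 1, x => O.boundary k x = 0

/-- Two `k`-chains are homologous on `K` if they differ by a boundary. -/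
def Homologous {R : Type*} [CommRing R] {k : ℕ} (z x : O.Chain R k) : Prop :=
  ∃ p : O.Chain R (k + 1), O.boundary k p = z - x

/-- The voids of `K`: the connected components of the complement of `|K|` in `ℝ^(q+1)`,
including the unbounded (outer) one. -/
def Void : Type :=
  {C : Set (Space q) // ∃ x ∈ (O.K.space)ᶜ, C = connectedComponentIn (O.K.space)ᶜ x}

/-- The `(q+1)`-dimensional cells of the voidless complex `K̄`: facet-simplices and voids. -/
abbrev Cell : Type := O.Facet ⊕ O.Void

/-- The side of the (hyperplane of the) oriented edge-simplex `e` on which the point `w` lies: this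
is positive iff `[w, e]` is oriented like the ambient space, so that `e` occurs with coefficient
`1` in the boundary of the positively oriented simplex `[w, e]`. -/
def side (e : O.Edge) (w : Space q) : ℝ :=
  (((O.ambient * O.sgn e.1 : ℤˣ) : ℤ) : ℝ) *
    orientDet (Fin.cons w (@Finset.orderEmbOfFin _ O.vord e.1 _ e.2.2))

/-- The void `ν` touches `e` from the side with sign `ε`: a short segment that leaves `e` at its
barycentre towards that side runs inside `ν`. -/
def VoidTouches (ε : ℤˣ) (e : O.Edge) (ν : O.Void) : Prop :=
  ∃ w : Space q, 0 < ((ε : ℤ) : ℝ) * O.side e w ∧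
    openSegment ℝ (e.1.centroid ℝ id) w ⊆ ν.1

/-- The cell `c` of `K̄` is a coface of `e` with incidence number `ε = ±1`, i.e. it lies on the
side of `e` with sign `ε`. -/
def IsCoface (ε : ℤˣ) (e : O.Edge) : O.Cell → Prop
  | Sum.inl τ => O.incidence τ e = (ε : ℤ)
  | Sum.inr ν => O.VoidTouches ε e ν

/-- `e = (η ⇀ τ)`: the oriented edge-simplex `e` points from the cell `η` to the cell `τ`, i.e. the
coboundary of `e` in `K̄` is `τ - η`. -/
def Dart (e : O.Edge) (η τ : O.Cell) : Prop :=
  O.IsCoface (-1) e η ∧ O.IsCoface 1 e τ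

section LP

variable {R : Type*} [CommRing R] [LinearOrder R] [IsStrictOrderedRing R]

/-- The data of the directed linear program. -/
structure DirData (R : Type*) where
  /-- the length-weights (capacities) of the edge-simplices -/
  c : O.Edge → R
  /-- the area-weights of the facet-simplices -/
  a : O.Facet → R
  /-- the input `q`-chain -/
  z : O.Chain R q
  /-- the source voids -/
  S : Finset O.Void
  /-- the sink voids -/
  T : Finset O.Void
  /-- the flow values at the source and sink voids -/
  γ : O.Void → R

/-- The variables of the directed dual linear program. -/
structure DirVar (R : Type*) where
  /-- the potential `π`, on facet-simplices and voids -/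
  pot : O.Cell → R
  /-- the positive component `π⁺` -/
  potPos : O.Facet → R
  /-- the negative component `π⁻` -/
  potNeg : O.Facet → R
  /-- the value of `x⃗` on the natural orientation `(η ⇀ τ)` of each edge-simplex -/
  xNat : O.Edge → R
  /-- the value of `x⃗` on the opposite orientation `(τ ⇀ η)` of each edge-simplex -/
  xOpp : O.Edge → R

variable {O}

/-- The objective function of the directed dual linear program. -/
def DirVar.cost (v : O.DirVar R) (d : O.DirData R) : R :=
  ∑ τ, d.a τ * v.potPos τ + ∑ τ, d.a τ * v.potNeg τ
    + ∑ ν ∈ d.T, d.γ ν * v.pot (Sum.inr ν) - ∑ ν ∈ d.S, d.γ ν * v.pot (Sum.inr ν)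
    + ∑ e, d.c e * (v.xNat e + v.xOpp e)

/-- The constraints of the directed dual linear program. -/
structure DirVar.Feasible (v : O.DirVar R) (d : O.DirData R) : Prop where
  nat : ∀ e η τ, O.Dart e η τ → v.pot η - v.pot τ + v.xNat e ≥ -d.z e
  opp : ∀ e η τ, O.Dart e η τ → v.pot τ - v.pot η + v.xOpp e ≥ d.z e
  xNat_nonneg : ∀ e, 0 ≤ v.xNat e
  xOpp_nonneg : ∀ e, 0 ≤ v.xOpp e
  void : ∀ ν, v.pot (Sum.inr ν) = 0
  potPos_nonneg : ∀ τ, 0 ≤ v.potPos τ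
  potNeg_nonneg : ∀ τ, 0 ≤ v.potNeg τ
  pot_eq : ∀ τ, v.pot (Sum.inl τ) = v.potPos τ - v.potNeg τ

/-- Optimal solutions of the directed dual linear program. -/
def DirVar.Optimal (v : O.DirVar R) (d : O.DirData R) : Prop :=
  v.Feasible d ∧ ∀ w : O.DirVar R, w.Feasible d → v.cost d ≤ w.cost d

/-- The potential as a `(q+1)`-chain of `K`. -/
def DirVar.chain (v : O.DirVar R) : O.Chain R (q + 1) := fun τ => v.pot (Sum.inl τ)

/-- The `q`-chain `x(η | τ) = x⃗(τ ⇀ η) - x⃗(η ⇀ τ)`. -/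
def DirVar.x (v : O.DirVar R) : O.Chain R q := fun e => v.xOpp e - v.xNat e

/-- The weighted `ℓ¹` cost `∑ wₛ |yₛ|` of a chain. -/
def weight {k : ℕ} (w : O.Simplex k → R) (y : O.Chain R k) : R := ∑ s, w s * |y s|

/-- `x` is a minimal `q`-cycle homologous to `z` on `K`, through the `(q+1)`-chain `p`, for the
(simplicial) flat norm: `x` is a cycle, `∂p = z - x`, and the total cost `c(|x|) + a(|p|)` is least
among all `q`-cycles homologous to `z` and all `(q+1)`-chains that realize the homology. -/
def IsMinimalCycle (d : O.DirData R) (x : O.Chain R q) (p : O.Chain R (q + 1)) : Prop :=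
  O.IsCycle q x ∧ O.Homologous d.z x ∧ O.boundary q p = d.z - x ∧
    ∀ (x' : O.Chain R q) (p' : O.Chain R (q + 1)), O.IsCycle q x' → O.boundary q p' = d.z - x' →
      weight d.c x + weight d.a p ≤ weight d.c x' + weight d.a p'

end LP

end OrientedComplex

end FlatNorm

end


/-!
The segment from the barycentre of an edge-simplex `e` to a point strictly on one of its sides
starts inside the facet-simplex on that side. If there is none, it starts off `|K|`, hence inside a
void: every simplex containing `e` lies weakly on the opposite side, and every other simplex misses
the barycentre. So `e` has a coface of each sign, the facet-simplices among them are unique, and as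
the potential vanishes on voids, `π(τ) - π(η) = (∂π)(e)` for `e = (η ⇀ τ)`.

The constraints on `x⃗` therefore bound it below by the negative and positive parts of `z - ∂π`.
Choosing it and `π^±` as small as possible turns the linear program into the minimization of
`c(|z - ∂π|) + a(|π|)` over all `(q+1)`-chains `π`, and `c > 0` forces an optimal `x⃗` to attain its
lower bounds, that is, `x = z - ∂π`.
-/

namespace FlatNorm

open Filter Topology

section AffineGeometry

variable {k V P ι : Type*} [AddCommGroup V] [AddTorsor V P]

theorem affineIndependent_cons [DivisionRing k] [Module k V] {n : ℕ} {p : Fin n → P} {w : P}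
    (hp : AffineIndependent k p) (hw : w ∉ affineSpan k (Set.range p)) :
    AffineIndependent k (Fin.cons w p : Fin (n + 1) → P) := by
  refine AffineIndependent.affineIndependent_of_notMem_span (i := 0) ?_ ?_
  · rw [← affineIndependent_equiv (finSuccAboveEquiv 0)]
    convert! hp using 1
  · have himage : (Fin.cons w p : Fin (n + 1) → P) '' {i | i ≠ 0} = Set.range p := by
      rw [show {i : Fin (n + 1) | i ≠ 0} = Set.range Fin.succ by ext; simp,
        ← Set.range_comp]
      rfl
    simpa only [himage, Fin.cons_zero] using hw

theorem centroid_notMem_affineSpan_image [DivisionRing k] [CharZero k] [Module k V] {p : ι → P}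
    (hp : AffineIndependent k p) {s : Finset ι} {t : Set ι} {i : ι} (his : i ∈ s) (hit : i ∉ t) :
    s.centroid k p ∉ affineSpan k (p '' t) := by
  intro hmem
  have hzero := hp.eq_zero_of_affineCombination_mem_affineSpan
    (s.sum_centroidWeights_eq_one_of_nonempty k ⟨i, his⟩) hmem his hit
  rw [Finset.centroidWeights_apply, inv_eq_zero, Nat.cast_eq_zero, Finset.card_eq_zero] at hzero
  exact Finset.notMem_empty i (hzero ▸ his)

theorem centroid_id_eq_centroid_subtype [DivisionRing k] [Module k V] [DecidableEq P]
    {s t : Finset P} (h : t ⊆ s) :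
    t.centroid k id = (t.subtype (· ∈ s)).centroid k Subtype.val := by
  conv_lhs => rw [← Finset.subtype_map_of_mem h, Finset.centroid_map]
  rfl

theorem affineMap_apply_eq_coord_mul [CommRing k] [Module k V] [Finite ι] (b : AffineBasis ι k P)
    (φ : P →ᵃ[k] k) {i : ι} (hφ : ∀ j ≠ i, φ (b j) = 0) (x : P) :
    φ x = b.coord i x * φ (b i) := by
  have := Fintype.ofFinite ι
  have hsum := b.sum_coord_apply_eq_one x
  calc φ x = φ (Finset.univ.affineCombination k b fun j => b.coord j x) := by
        rw [b.affineCombination_coord_eq_self]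
    _ = ∑ j, b.coord j x * φ (b j) := by
        rw [Finset.map_affineCombination _ _ _ hsum,
          Finset.affineCombination_eq_linear_combination _ _ _ hsum]
        rfl
    _ = b.coord i x * φ (b i) :=
        Fintype.sum_eq_single i fun j hj => by rw [hφ j hj, mul_zero]

end AffineGeometry

section Segments

variable {E ι : Type*} [AddCommGroup E] [Module ℝ E]

theorem eventually_lineMap_mem_openSegment (x y : E) :
    ∀ᶠ t in 𝓝[>] (0 : ℝ), AffineMap.lineMap x y t ∈ openSegment ℝ x y := by
  filter_upwards [Ioo_mem_nhdsGT (zero_lt_one' ℝ)] with t ht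
  rw [openSegment_eq_image_lineMap]
  exact ⟨t, ht, rfl⟩

theorem exists_openSegment_lineMap_subset {x y : E} {U : Set E}
    (h : ∀ᶠ t in 𝓝[>] (0 : ℝ), AffineMap.lineMap x y t ∈ U) :
    ∃ r > (0 : ℝ), openSegment ℝ x (AffineMap.lineMap x y r) ⊆ U := by
  obtain ⟨r, hr, hrU⟩ := mem_nhdsGT_iff_exists_Ioo_subset.1 h
  refine ⟨r, hr, ?_⟩
  rw [openSegment_eq_image_lineMap]
  rintro _ ⟨t, ht, rfl⟩
  rw [AffineMap.lineMap_lineMap_right]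
  exact hrU ⟨mul_pos ht.1 hr, mul_lt_of_lt_one_left hr ht.2⟩

theorem eventually_lineMap_notMem [TopologicalSpace E] [IsTopologicalAddGroup E]
    [ContinuousSMul ℝ E] {x y : E} {C : Set E} (hC : IsClosed C) (hx : x ∉ C) :
    ∀ᶠ t in 𝓝[>] (0 : ℝ), AffineMap.lineMap x y t ∉ C := by
  have htendsto : Tendsto (AffineMap.lineMap x y : ℝ → E) (𝓝 0) (𝓝 x) := by
    have hcont : Continuous (AffineMap.lineMap x y : ℝ → E) := AffineMap.lineMap_continuous
    simpa only [AffineMap.lineMap_apply_zero] using hcont.tendsto 0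
  exact nhdsWithin_le_nhds (htendsto.eventually (hC.isOpen_compl.mem_nhds hx))

theorem eventually_lineMap_mem_convexHull_range [Finite ι] (b : AffineBasis ι ℝ E) {i : ι} {x y : E}
    (hx : ∀ j ≠ i, 0 < b.coord j x) (hxi : 0 ≤ b.coord i x) (hyi : 0 ≤ b.coord i y) :
    ∀ᶠ t in 𝓝[>] (0 : ℝ), AffineMap.lineMap x y t ∈ convexHull ℝ (Set.range b) := by
  rw [b.convexHull_eq_nonneg_coord]
  refine eventually_all.2 fun j => ?_
  simp only [AffineMap.apply_lineMap]
  rcases eq_or_ne j i with rfl | hj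
  · filter_upwards [Ioo_mem_nhdsGT (zero_lt_one' ℝ)] with t ht
    rw [AffineMap.lineMap_apply_ring]
    exact add_nonneg (mul_nonneg (sub_nonneg.2 ht.2.le) hxi) (mul_nonneg ht.1.le hyi)
  · filter_upwards [eventually_lineMap_notMem (y := b.coord j y) isClosed_Iic
      (show b.coord j x ∉ Set.Iic 0 from (hx j hj).not_ge)] with t ht
    exact (not_le.1 ht).le

end Segments

theorem centroid_notMem_convexHull_of_not_subset {𝕜 E : Type*} [Field 𝕜] [LinearOrder 𝕜]
    [IsStrictOrderedRing 𝕜] [AddCommGroup E] [Module 𝕜 E] {K : Geometry.SimplicialComplex 𝕜 E}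
    {s t : Finset E} (hs : s ∈ K.faces) (ht : t ∈ K.faces) (hst : ¬ s ⊆ t) :
    s.centroid 𝕜 id ∉ convexHull 𝕜 (t : Set E) := by
  classical
  intro hmem
  obtain ⟨v, hvs, hvt⟩ := Finset.not_subset.1 hst
  have hmem_inter : s.centroid 𝕜 id ∈ convexHull 𝕜 (s ∩ t : Set E) :=
    K.inter_subset_convexHull hs ht
      ⟨s.centroid_mem_convexHull (K.nonempty_of_mem_faces hs), hmem⟩
  have hnotMem := centroid_notMem_affineSpan_image (k := 𝕜) (K.indep hs)
    (s := s.subtype (· ∈ s)) (t := Subtype.val ⁻¹' (t : Set E)) (i := ⟨v, hvs⟩)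
    (Finset.mem_subtype.2 hvs) hvt
  rw [← centroid_id_eq_centroid_subtype subset_rfl,
    show (Subtype.val '' (Subtype.val ⁻¹' (t : Set E) : Set s)) = (s ∩ t : Set E) from
      Subtype.image_preimage_coe _ _] at hnotMem
  exact hnotMem (convexHull_subset_affineSpan _ hmem_inter)

section Orientation

variable {q : ℕ}

theorem orientDet_cons_removeNth (p : Fin (q + 2) → Space q) (i : Fin (q + 2)) :
    orientDet (Fin.cons (p i) (i.removeNth p)) = (-1) ^ (i : ℕ) * orientDet p := by
  have hsign : Equiv.Perm.sign i.cycleRange.symm = (-1) ^ (i : ℕ) := by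
    rw [Equiv.Perm.sign_symm, Fin.sign_cycleRange]
  rw [Fin.cons_removeNth_eq_comp_cycleRange_symm]
  simpa [orientDet, Matrix.submatrix, Function.comp_def, hsign] using
    Matrix.det_permute i.cycleRange.symm
      (Matrix.of fun j => (Fin.cons 1 (p j) : Fin (q + 2) → ℝ))

theorem orientDet_ne_zero {p : Fin (q + 2) → Space q} (hp : AffineIndependent ℝ p) :
    orientDet p ≠ 0 := by
  intro hdet
  obtain ⟨v, hv, hvM⟩ := Matrix.exists_vecMul_eq_zero_iff.2 hdet
  have hsum : ∑ i, v i = 0 := by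
    simpa [Matrix.vecMul, dotProduct] using congrFun hvM 0
  have hcomb : ∑ i, v i • p i = 0 := by
    ext k
    simpa [Matrix.vecMul, dotProduct] using congrFun hvM k.succ
  exact hv (funext fun i => hp.eq_zero_of_sum_eq_zero hsum hcomb i (Finset.mem_univ i))

theorem orientDet_cons_self (f : Fin (q + 1) → Space q) (i : Fin (q + 1)) :
    orientDet (Fin.cons (f i) f) = 0 :=
  Matrix.det_zero_of_row_eq (Fin.succ_ne_zero i).symm rfl

theorem orientDet_cons_eq_det_updateRow (f : Fin (q + 1) → Space q) (w : Space q) :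
    orientDet (Fin.cons w f) =
      ((Matrix.of fun i => Fin.cons 1 ((Fin.cons 0 f : Fin (q + 2) → Space q) i) :
          Matrix (Fin (q + 2)) (Fin (q + 2)) ℝ).updateRow 0 (Fin.cons 1 w)).det := by
  refine congrArg Matrix.det (Matrix.ext fun i j => ?_)
  refine Fin.cases ?_ (fun i => ?_) i <;> simp

/-- The orientation determinant of `[w, f₀, …, f_q]` as an affine function of `w`. -/
noncomputable def orientForm (f : Fin (q + 1) → Space q) : Space q →ᵃ[ℝ] ℝ where
  toFun w := orientDet (Fin.cons w f)
  linear :=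
    let M : Matrix (Fin (q + 2)) (Fin (q + 2)) ℝ :=
      Matrix.of fun i => Fin.cons 1 ((Fin.cons 0 f : Fin (q + 2) → Space q) i)
    { toFun := fun v => (M.updateRow 0 (Fin.cons 0 v)).det
      map_add' := fun v v' => by
        rw [← Matrix.det_updateRow_add]
        congr 2
        ext j
        refine Fin.cases ?_ (fun j => ?_) j <;> simp
      map_smul' := fun r v => by
        rw [RingHom.id_apply, smul_eq_mul, ← Matrix.det_updateRow_smul]
        congr 2
        ext j
        refine Fin.cases ?_ (fun j => ?_) j <;> simp }
  map_vadd' w v := by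
    simp only [orientDet_cons_eq_det_updateRow, vadd_eq_add, LinearMap.coe_mk, AddHom.coe_mk]
    rw [← Matrix.det_updateRow_add]
    congr 2
    ext j
    refine Fin.cases ?_ (fun j => ?_) j <;> simp

end Orientation
section LinearOrder

variable {α : Type*} [LinearOrder α] {n : ℕ} {s : Finset α}

theorem orderEmbOfFin_eq_removeNth (hs : s.card = n + 1) {i : Fin (n + 1)} {t : Finset α}
    (ht : t.card = n) (hts : t ⊆ s) (hi : s.orderEmbOfFin hs i ∉ t) :
    t.orderEmbOfFin ht = i.removeNth (s.orderEmbOfFin hs) := by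
  have hcover : insert (s.orderEmbOfFin hs i) t = s :=
    Finset.eq_of_subset_of_card_le (Finset.insert_subset (s.orderEmbOfFin_mem hs i) hts)
      (by rw [Finset.card_insert_of_notMem hi, hs, ht])
  refine (Finset.orderEmbOfFin_unique ht (fun j => ?_) fun j j' hj => ?_).symm
  · exact Finset.mem_of_mem_insert_of_ne (hcover.symm ▸ s.orderEmbOfFin_mem hs (i.succAbove j))
      fun h => i.succAbove_ne j ((s.orderEmbOfFin hs).injective h)
  · exact (s.orderEmbOfFin hs).strictMono (i.strictMono_succAbove hj)

theorem card_filter_lt_orderEmbOfFin (hs : s.card = n) (i : Fin n) :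
    (s.filter (· < s.orderEmbOfFin hs i)).card = i := by
  have hmap : s.filter (· < s.orderEmbOfFin hs i) =
      (Finset.Iio i).map (s.orderEmbOfFin hs).toEmbedding := by
    ext u
    constructor
    · intro hu
      obtain ⟨hus, hui⟩ := Finset.mem_filter.1 hu
      obtain ⟨j, rfl⟩ : u ∈ Set.range (s.orderEmbOfFin hs) := by simpa using hus
      simpa using hui
    · rintro hu
      obtain ⟨j, hj, rfl⟩ := Finset.mem_map.1 hu
      simpa using hj
  rw [hmap, Finset.card_map, Fin.card_Iio]

end LinearOrder

namespace OrientedComplex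

section Incidence

variable {q k : ℕ} (O : OrientedComplex q)

open Classical in
/-- The number of vertices of `s` before `w` in the auxiliary order of the vertices, i.e. the
position at which `w` is inserted into `s`. -/
noncomputable def rank (s : Finset (Space q)) (w : Space q) : ℕ :=
  (s.filter fun u => O.vord.lt u w).card

theorem rank_insert_of_lt {s : Finset (Space q)} {v w : Space q} (hv : v ∉ s)
    (hvw : O.vord.lt v w) : O.rank (insert v s) w = O.rank s w + 1 := by
  classical
  rw [rank, Finset.filter_insert, if_pos hvw, Finset.card_insert_of_notMem (by simp [hv]), rank]

theorem rank_insert_of_not_lt (s : Finset (Space q)) {v w : Space q} (hvw : ¬ O.vord.lt v w) :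
    O.rank (insert v s) w = O.rank s w := by
  classical
  rw [rank, Finset.filter_insert, if_neg hvw, rank]

variable {O}

theorem exists_insert_eq {s : O.Simplex (k + 1)} {t : O.Simplex k} (hts : t.1 ⊆ s.1) :
    ∃ w ∉ t.1, insert w t.1 = s.1 :=
  Finset.exists_eq_insert_iff.2 ⟨hts, by rw [s.2.2, t.2.2]⟩

open Classical in
theorem insert_eq_of_mem_of_notMem {s : O.Simplex (k + 1)} {t : O.Simplex k} {v : Space q}
    (hts : t.1 ⊆ s.1) (hv : v ∈ s.1) (hvt : v ∉ t.1) : insert v t.1 = s.1 :=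
  Finset.eq_of_subset_of_card_le (Finset.insert_subset hv hts)
    (by rw [Finset.card_insert_of_notMem hvt, s.2.2, t.2.2])

open Classical in
theorem exists_simplex_eq_insert {r : Finset (Space q)} (hr : r ∈ O.K.faces) {t : O.Simplex k}
    {w : Space q} (hw : w ∉ t.1) (hwt : insert w t.1 ⊆ r) :
    ∃ s : O.Simplex (k + 1), insert w t.1 = s.1 :=
  ⟨⟨insert w t.1, O.K.down_closed hr hwt (Finset.insert_nonempty w t.1),
    by rw [Finset.card_insert_of_notMem hw, t.2.2]⟩, rfl⟩

theorem incidence_of_insert_eq {s : O.Simplex (k + 1)} {t : O.Simplex k} {w : Space q}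
    (hw : w ∉ t.1) (hs : insert w t.1 = s.1) :
    O.incidence s t = ((O.sgn s.1 * O.sgn t.1 : ℤˣ) : ℤ) * (-1) ^ O.rank t.1 w := by
  classical
  have hfilter : (s.1.filter fun u => ∃ v ∈ s.1, v ∉ t.1 ∧ O.vord.lt u v) =
      (insert w t.1).filter fun u => O.vord.lt u w := by
    rw [← hs]
    refine Finset.filter_congr fun u _ => ⟨?_, fun h => ⟨w, Finset.mem_insert_self w _, hw, h⟩⟩
    rintro ⟨v, hv, hvt, huv⟩
    rwa [← (Finset.mem_insert.1 hv).resolve_right hvt]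
  rw [incidence, if_pos (hs ▸ Finset.subset_insert w t.1), hfilter,
    ← O.rank_insert_of_not_lt t.1 (@lt_irrefl _ O.vord.toPreorder w)]
  rfl

theorem subset_of_incidence_ne_zero {s : O.Simplex (k + 1)} {t : O.Simplex k}
    (h : O.incidence s t ≠ 0) : t.1 ⊆ s.1 := by
  by_contra hts
  exact h (if_neg hts)

theorem subset_of_incidence_eq {s : O.Simplex (k + 1)} {t : O.Simplex k} {ε : ℤˣ}
    (h : O.incidence s t = ε) : t.1 ⊆ s.1 :=
  subset_of_incidence_ne_zero (h ▸ ε.ne_zero)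

theorem exists_unit_eq_incidence {s : O.Simplex (k + 1)} {t : O.Simplex k} (hts : t.1 ⊆ s.1) :
    ∃ ε : ℤˣ, O.incidence s t = ε := by
  obtain ⟨w, hw, hs⟩ := exists_insert_eq hts
  exact ⟨O.sgn s.1 * O.sgn t.1 * (-1) ^ O.rank t.1 w, by simp [incidence_of_insert_eq hw hs]⟩

/-- The two paths from `r` down to `t` have opposite signs because inserting `a` first raises the
position of `b > a` by one. -/
theorem incidence_mul_incidence_add {r : O.Simplex (k + 2)} {s s' : O.Simplex (k + 1)}
    {t : O.Simplex k} {a b : Space q} (ha : a ∉ t.1) (hb : b ∉ t.1) (hab : O.vord.lt a b)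
    (hs : insert a t.1 = s.1) (hs' : insert b t.1 = s'.1) (hsr : insert b s.1 = r.1)
    (hsr' : insert a s'.1 = r.1) :
    O.incidence r s * O.incidence s t + O.incidence r s' * O.incidence s' t = 0 := by
  have hne : a ≠ b := @ne_of_lt _ O.vord.toPreorder a b hab
  have hbs : b ∉ s.1 := by simp [← hs, hb, hne.symm]
  have has' : a ∉ s'.1 := by simp [← hs', ha, hne]
  have hrank : O.rank s.1 b = O.rank t.1 b + 1 := by rw [← hs, O.rank_insert_of_lt ha hab]
  have hrank' : O.rank s'.1 a = O.rank t.1 a := by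
    rw [← hs', O.rank_insert_of_not_lt t.1 (@lt_asymm _ O.vord.toPreorder a b hab)]
  have hsq (ε : ℤˣ) : (ε : ℤ) * ε = 1 := by rw [← Units.val_mul, Int.units_mul_self, Units.val_one]
  rw [incidence_of_insert_eq hbs hsr, incidence_of_insert_eq ha hs,
    incidence_of_insert_eq has' hsr', incidence_of_insert_eq hb hs', hrank, hrank']
  push_cast
  linear_combination (-1) ^ O.rank t.1 a * (-1) ^ O.rank t.1 b * O.sgn r.1 * O.sgn t.1 *
    (hsq (O.sgn s'.1) - hsq (O.sgn s.1))

open Classical in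
theorem exists_insert_eq_of_incidence_mul_ne_zero {r : O.Simplex (k + 2)} {s : O.Simplex (k + 1)}
    {t : O.Simplex k} (h : O.incidence r s * O.incidence s t ≠ 0) :
    ∃ w ∈ r.1 \ t.1, insert w t.1 = s.1 := by
  obtain ⟨w, hwt, hw⟩ := exists_insert_eq (subset_of_incidence_ne_zero (right_ne_zero_of_mul h))
  have hwr : w ∈ r.1 :=
    subset_of_incidence_ne_zero (left_ne_zero_of_mul h) (hw ▸ Finset.mem_insert_self w t.1)
  exact ⟨w, Finset.mem_sdiff.2 ⟨hwr, hwt⟩, hw⟩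

theorem exists_lt_and_sdiff_eq_pair {r : O.Simplex (k + 2)} {t : O.Simplex k} (htr : t.1 ⊆ r.1) :
    ∃ a b, O.vord.lt a b ∧ r.1 \ t.1 = {a, b} := by
  have hcard : (r.1 \ t.1).card = 2 := by
    rw [Finset.card_sdiff_of_subset htr, r.2.2, t.2.2]
    lia
  obtain ⟨a, b, hne, hdiff⟩ := Finset.card_eq_two.1 hcard
  rcases @lt_or_gt_of_ne _ O.vord a b hne with h | h
  · exact ⟨a, b, h, hdiff⟩
  · exact ⟨b, a, h, hdiff.trans (Finset.pair_comm a b)⟩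

theorem sum_incidence_mul_incidence (r : O.Simplex (k + 2)) (t : O.Simplex k) :
    ∑ s, O.incidence r s * O.incidence s t = 0 := by
  classical
  by_cases htr : t.1 ⊆ r.1
  swap
  · refine Finset.sum_eq_zero fun s _ => by_contra fun h => htr ?_
    exact (subset_of_incidence_ne_zero (right_ne_zero_of_mul h)).trans
      (subset_of_incidence_ne_zero (left_ne_zero_of_mul h))
  obtain ⟨a, b, hab, hdiff⟩ := exists_lt_and_sdiff_eq_pair htr
  have hne : a ≠ b := @ne_of_lt _ O.vord.toPreorder a b hab
  obtain ⟨har, hat⟩ : a ∈ r.1 ∧ a ∉ t.1 := Finset.mem_sdiff.1 (by simp [hdiff])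
  obtain ⟨hbr, hbt⟩ : b ∈ r.1 ∧ b ∉ t.1 := Finset.mem_sdiff.1 (by simp [hdiff])
  obtain ⟨s, hs⟩ := exists_simplex_eq_insert r.2.1 hat (Finset.insert_subset har htr)
  obtain ⟨s', hs'⟩ := exists_simplex_eq_insert r.2.1 hbt (Finset.insert_subset hbr htr)
  have hr : insert a (insert b t.1) = r.1 := by
    rw [← Finset.sdiff_union_of_subset htr, hdiff, Finset.insert_union, Finset.singleton_union]
  have hss' : s ≠ s' := by
    rintro rfl
    have hab' : a ∈ insert b t.1 := hs' ▸ hs ▸ Finset.mem_insert_self a t.1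
    exact hat ((Finset.mem_insert.1 hab').resolve_left hne)
  rw [Fintype.sum_eq_add s s' hss' fun u hu => ?_]
  · refine incidence_mul_incidence_add hat hbt hab hs hs' ?_ ?_
    · rw [← hs, Finset.insert_comm, hr]
    · rw [← hs', hr]
  · by_contra h
    obtain ⟨w, hw, hwu⟩ := exists_insert_eq_of_incidence_mul_ne_zero h
    rw [hdiff, Finset.mem_insert, Finset.mem_singleton] at hw
    rcases hw with rfl | rfl
    · exact hu.1 (Subtype.ext (hwu.symm.trans hs))
    · exact hu.2 (Subtype.ext (hwu.symm.trans hs'))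

end Incidence

section Boundary

variable {R : Type*} [CommRing R] {q k : ℕ} {O : OrientedComplex q}

theorem boundary_eq_mulVec (y : O.Chain R (k + 1)) :
    O.boundary k y = (Matrix.of fun t s => (O.incidence s t : R)).mulVec y :=
  rfl

theorem boundary_sub (y y' : O.Chain R (k + 1)) :
    O.boundary k (y - y') = O.boundary k y - O.boundary k y' := by
  simp only [boundary_eq_mulVec, Matrix.mulVec_sub]

theorem boundary_boundary (y : O.Chain R (k + 2)) : O.boundary k (O.boundary (k + 1) y) = 0 := by
  simp only [boundary_eq_mulVec, Matrix.mulVec_mulVec]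
  refine (congrArg (Matrix.mulVec · y) (Matrix.ext fun t r => ?_)).trans (Matrix.zero_mulVec y)
  have hsum := congrArg (Int.cast : ℤ → R) (sum_incidence_mul_incidence r t)
  push_cast at hsum
  simpa only [Matrix.mul_apply, Matrix.of_apply, Matrix.zero_apply, mul_comm] using hsum

theorem isCycle_boundary (y : O.Chain R (k + 1)) : O.IsCycle k (O.boundary k y) := by
  cases k with
  | zero => trivial
  | succ k => exact boundary_boundary y

theorem IsCycle.sub {x y : O.Chain R k} (hx : O.IsCycle k x) (hy : O.IsCycle k y) :
    O.IsCycle k (x - y) := by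
  cases k with
  | zero => trivial
  | succ k => exact (boundary_sub x y).trans (by rw [hx, hy, sub_zero])

end Boundary

section Side

variable {q : ℕ} {O : OrientedComplex q} {e : O.Edge} {τ : O.Facet} {ε : ℤˣ} {w x : Space q}

/-- The function `side e`, as an affine map. -/
noncomputable def sideMap (e : O.Edge) : Space q →ᵃ[ℝ] ℝ :=
  (((O.ambient * O.sgn e.1 : ℤˣ) : ℤ) : ℝ) •
    orientForm (@Finset.orderEmbOfFin _ O.vord e.1 _ e.2.2)

theorem sideMap_apply (e : O.Edge) (w : Space q) : O.sideMap e w = O.side e w :=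
  rfl

theorem side_eq_zero_of_mem (hw : w ∈ e.1) : O.side e w = 0 := by
  let := O.vord
  obtain ⟨i, rfl⟩ : w ∈ Set.range (e.1.orderEmbOfFin e.2.2) := by simpa using hw
  exact mul_eq_zero_of_right _ (orientDet_cons_self _ i)

theorem side_eq_zero_of_mem_convexHull (hx : x ∈ convexHull ℝ (e.1 : Set (Space q))) :
    O.side e x = 0 :=
  convexHull_min (fun _ hv => side_eq_zero_of_mem hv)
    ((convex_singleton (0 : ℝ)).affine_preimage (O.sideMap e)) hx

/-- The barycentre of an edge-simplex, where segments that touch it from one side start. -/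
noncomputable def barycentre (e : O.Edge) : Space q :=
  e.1.centroid ℝ id

theorem side_barycentre (e : O.Edge) : O.side e (barycentre e) = 0 :=
  side_eq_zero_of_mem_convexHull
    (e.1.centroid_mem_convexHull (O.K.nonempty_of_mem_faces e.2.1))

theorem side_lineMap_barycentre (e : O.Edge) (w : Space q) (t : ℝ) :
    O.side e (AffineMap.lineMap (barycentre e) w t) = t * O.side e w := by
  rw [← sideMap_apply, AffineMap.apply_lineMap, AffineMap.lineMap_apply_ring, sideMap_apply,
    sideMap_apply, side_barycentre, mul_zero, zero_add]

theorem exists_side_ne_zero (e : O.Edge) : ∃ w, O.side e w ≠ 0 := by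
  let := O.vord
  have hindep : AffineIndependent ℝ (e.1.orderEmbOfFin e.2.2) :=
    (O.K.indep e.2.1).comp_embedding (e.1.orderIsoOfFin e.2.2).toEmbedding
  have hspan : affineSpan ℝ (Set.range (e.1.orderEmbOfFin e.2.2)) ≠ ⊤ := by
    rw [Ne, hindep.affineSpan_eq_top_iff_card_eq_finrank_add_one]
    simp
  obtain ⟨w, -, hw⟩ := SetLike.exists_of_lt hspan.lt_top
  refine ⟨w, mul_ne_zero ?_ (orientDet_ne_zero (affineIndependent_cons hindep hw))⟩
  exact_mod_cast (O.ambient * O.sgn e.1).ne_zero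

theorem exists_side_pos (e : O.Edge) (ε : ℤˣ) : ∃ w, 0 < ((ε : ℤ) : ℝ) * O.side e w := by
  obtain ⟨w, hw⟩ := exists_side_ne_zero e
  have hne : ((ε : ℤ) : ℝ) * O.side e w ≠ 0 := mul_ne_zero (by exact_mod_cast ε.ne_zero) hw
  rcases hne.lt_or_gt with hneg | hpos
  · refine ⟨AffineMap.lineMap (barycentre e) w (-1 : ℝ), ?_⟩
    rw [side_lineMap_barycentre]
    linarith
  · exact ⟨w, hpos⟩

theorem exists_side_eq_incidence_mul (hw : w ∉ e.1) (hτ : insert w e.1 = τ.1) :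
    ∃ D > 0, O.side e w = O.incidence τ e * D := by
  let := O.vord
  obtain ⟨i, hi⟩ : w ∈ Set.range (τ.1.orderEmbOfFin τ.2.2) := by simp [← hτ]
  have heτ : e.1 ⊆ τ.1 := hτ ▸ Finset.subset_insert w e.1
  have hrank : O.rank e.1 w = i := by
    rw [← card_filter_lt_orderEmbOfFin τ.2.2 i, hi,
      ← O.rank_insert_of_not_lt e.1 (lt_irrefl w), hτ, rank]
  have hsq : ((O.sgn τ.1 : ℤ) : ℝ) * (O.sgn τ.1 : ℤ) = 1 := by
    exact_mod_cast congrArg (Int.cast ∘ Units.val) (Int.units_mul_self (O.sgn τ.1))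
  refine ⟨_, O.facet_oriented τ.1 τ.2.1 τ.2.2, ?_⟩
  rw [incidence_of_insert_eq hw hτ, hrank, side, 
    orderEmbOfFin_eq_removeNth τ.2.2 e.2.2 heτ (hi ▸ hw), ← hi, orientDet_cons_removeNth]
  push_cast
  linear_combination -(O.ambient : ℤ) * (O.sgn e.1 : ℤ) * (-1 : ℝ) ^ (i : ℕ) *
    orientDet (τ.1.orderEmbOfFin τ.2.2) * hsq

theorem incidence_eq_iff_side_pos (hw : w ∉ e.1) (hτ : insert w e.1 = τ.1) :
    O.incidence τ e = ε ↔ 0 < ((ε : ℤ) : ℝ) * O.side e w := by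
  obtain ⟨D, hD, hside⟩ := exists_side_eq_incidence_mul hw hτ
  obtain ⟨δ, hδ⟩ := exists_unit_eq_incidence (hτ ▸ Finset.subset_insert w e.1)
  rw [hside, hδ]
  rcases Int.units_eq_one_or ε with rfl | rfl <;> rcases Int.units_eq_one_or δ with rfl | rfl <;>
    simp [hD, hD.le]

end Side

section Facet

variable {q : ℕ} {O : OrientedComplex q} {e : O.Edge} {τ : O.Facet} {ε : ℤˣ} {w : Space q}

/-- The vertices of a facet-simplex as an affine basis of the ambient space. -/
noncomputable def facetBasis (τ : O.Facet) : AffineBasis τ.1 ℝ (Space q) where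
  toFun := Subtype.val
  ind' := O.K.indep τ.2.1
  tot' := by
    rw [(O.K.indep τ.2.1).affineSpan_eq_top_iff_card_eq_finrank_add_one]
    simp [τ.2.2]

theorem convexHull_range_facetBasis (τ : O.Facet) :
    convexHull ℝ (Set.range (facetBasis τ)) = convexHull ℝ (τ.1 : Set (Space q)) :=
  congrArg (convexHull ℝ) Subtype.range_coe

theorem coord_barycentre_pos (heτ : e.1 ⊆ τ.1) {v : τ.1} (hv : v.1 ∈ e.1) :
    0 < (facetBasis τ).coord v (barycentre e) := by
  classical
  have hbary : barycentre e = (e.1.subtype (· ∈ τ.1)).centroid ℝ (facetBasis τ) :=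
    centroid_id_eq_centroid_subtype heτ
  have hv' : v ∈ e.1.subtype (· ∈ τ.1) := Finset.mem_subtype.2 hv
  rw [hbary, AffineBasis.coord_apply_centroid _ hv', inv_pos, Nat.cast_pos]
  exact Finset.card_pos.2 ⟨v, hv'⟩

theorem side_eq_coord_mul (hτ : insert w e.1 = τ.1) (hwτ : w ∈ τ.1) (x : Space q) :
    O.side e x = (facetBasis τ).coord ⟨w, hwτ⟩ x * O.side e w := by
  refine affineMap_apply_eq_coord_mul (facetBasis τ) (O.sideMap e) (fun v hv => ?_) x
  have hvw : v.1 ≠ w := fun h => hv (Subtype.ext h)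
  exact side_eq_zero_of_mem (Finset.mem_of_mem_insert_of_ne (hτ.superset v.2) hvw)

theorem eventually_lineMap_mem_convexHull_facet (hτ : O.incidence τ e = ε)
    (hw : 0 < ((ε : ℤ) : ℝ) * O.side e w) :
    ∀ᶠ t in 𝓝[>] (0 : ℝ),
      AffineMap.lineMap (barycentre e) w t ∈ convexHull ℝ (τ.1 : Set (Space q)) := by
  have heτ : e.1 ⊆ τ.1 := subset_of_incidence_eq hτ
  obtain ⟨v, hve, hv⟩ := exists_insert_eq heτ
  have hvτ : v ∈ τ.1 := hv ▸ Finset.mem_insert_self v e.1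
  have hv_pos : 0 < ((ε : ℤ) : ℝ) * O.side e v := (incidence_eq_iff_side_pos hve hv).1 hτ
  rw [← convexHull_range_facetBasis]
  refine eventually_lineMap_mem_convexHull_range _ (i := ⟨v, hvτ⟩) (fun u hu => ?_) ?_ ?_
  · exact coord_barycentre_pos heτ
      (Finset.mem_of_mem_insert_of_ne (hv.superset u.2) fun h => hu (Subtype.ext h))
  · have hbary := side_eq_coord_mul hv hvτ (barycentre e)
    rw [side_barycentre, zero_eq_mul] at hbary
    exact (hbary.resolve_right (right_ne_zero_of_mul hv_pos.ne')).ge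
  · rw [side_eq_coord_mul hv hvτ w, mul_left_comm] at hw
    exact (pos_of_mul_pos_left hw hv_pos.le).le

theorem facet_eq_of_incidence_eq {σ : O.Facet} (hτ : O.incidence τ e = ε)
    (hσ : O.incidence σ e = ε) : τ = σ := by
  by_contra hne
  obtain ⟨w, hw⟩ := exists_side_pos e ε
  obtain ⟨t, hmem, ht⟩ := (((eventually_lineMap_mem_convexHull_facet hτ hw).and
    (eventually_lineMap_mem_convexHull_facet hσ hw)).and self_mem_nhdsWithin).exists
  have hinter : (τ.1 ∩ σ.1 : Set (Space q)) ⊆ e.1 := by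
    rintro v ⟨hvτ, hvσ⟩
    by_contra hve
    exact hne (Subtype.ext <|
      (insert_eq_of_mem_of_notMem (subset_of_incidence_eq hτ) hvτ hve).symm.trans
        (insert_eq_of_mem_of_notMem (subset_of_incidence_eq hσ) hvσ hve))
  have hzero := side_eq_zero_of_mem_convexHull
    (convexHull_mono hinter (O.K.inter_subset_convexHull τ.2.1 σ.2.1 hmem))
  rw [side_lineMap_barycentre] at hzero
  exact mul_ne_zero (ne_of_gt ht) (right_ne_zero_of_mul hw.ne') hzero

end Facet

section Void

variable {q : ℕ} {O : OrientedComplex q} {e : O.Edge} {τ : O.Facet} {ε : ℤˣ} {w x : Space q}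

theorem Void.subset_compl_space (ν : O.Void) : ν.1 ⊆ (O.K.space)ᶜ := by
  obtain ⟨_, x, -, rfl⟩ := ν
  exact connectedComponentIn_subset _ _

theorem not_voidTouches_of_incidence_eq (hτ : O.incidence τ e = ε) (ν : O.Void) :
    ¬ O.VoidTouches ε e ν := by
  rintro ⟨w, hw, hν⟩
  obtain ⟨t, htτ, ht⟩ := ((eventually_lineMap_mem_convexHull_facet hτ hw).and
    (eventually_lineMap_mem_openSegment (barycentre e) w)).exists
  exact ν.subset_compl_space (hν ht) (O.K.convexHull_subset_space τ.2.1 htτ)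

theorem mul_side_nonpos (h : ∀ τ, O.incidence τ e ≠ ε) {s : Finset (Space q)}
    (hs : s ∈ O.K.faces) (hes : e.1 ⊆ s) (hx : x ∈ convexHull ℝ (s : Set (Space q))) :
    ((ε : ℤ) : ℝ) * O.side e x ≤ 0 := by
  refine convexHull_min (t := {x | ((ε : ℤ) : ℝ) * O.side e x ≤ 0}) (fun v hv => ?_)
    ((convex_Iic (0 : ℝ)).affine_preimage (((ε : ℤ) : ℝ) • O.sideMap e)) hx
  by_cases hve : v ∈ e.1
  · exact (mul_eq_zero_of_right _ (side_eq_zero_of_mem hve)).le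
  · obtain ⟨τ, hτ⟩ := exists_simplex_eq_insert hs hve (Finset.insert_subset hv hes)
    exact not_lt.1 ((incidence_eq_iff_side_pos hve hτ).not.1 (h τ))

theorem eventually_lineMap_mem_compl_space (h : ∀ τ, O.incidence τ e ≠ ε)
    (hw : 0 < ((ε : ℤ) : ℝ) * O.side e w) :
    ∀ᶠ t in 𝓝[>] (0 : ℝ), AffineMap.lineMap (barycentre e) w t ∈ (O.K.space)ᶜ := by
  have hface : ∀ s ∈ O.K.faces, ∀ᶠ t in 𝓝[>] (0 : ℝ),
      AffineMap.lineMap (barycentre e) w t ∉ convexHull ℝ (s : Set (Space q)) := by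
    intro s hs
    by_cases hes : e.1 ⊆ s
    · filter_upwards [self_mem_nhdsWithin] with t ht hts
      refine (mul_side_nonpos h hs hes hts).not_gt ?_
      rw [side_lineMap_barycentre, mul_left_comm]
      exact mul_pos ht hw
    · exact eventually_lineMap_notMem (s.finite_toSet.isClosed_convexHull ℝ)
        (centroid_notMem_convexHull_of_not_subset e.2.1 hs hes)
  filter_upwards [(eventually_all_finite O.finite_faces).2 hface] with t ht hspace
  obtain ⟨s, hs, hts⟩ := O.K.mem_space_iff.1 hspace
  exact ht s hs hts

theorem exists_voidTouches (h : ∀ τ, O.incidence τ e ≠ ε) : ∃ ν, O.VoidTouches ε e ν := by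
  obtain ⟨w, hw⟩ := exists_side_pos e ε
  obtain ⟨r, hr, hsegment⟩ :=
    exists_openSegment_lineMap_subset (eventually_lineMap_mem_compl_space h hw)
  obtain ⟨x, hx⟩ : (openSegment ℝ (barycentre e) (AffineMap.lineMap (barycentre e) w r)).Nonempty :=
    ⟨_, midpoint_mem_openSegment _ _⟩
  refine ⟨⟨_, x, hsegment hx, rfl⟩, AffineMap.lineMap (barycentre e) w r, ?_, ?_⟩
  · rw [side_lineMap_barycentre, mul_left_comm]
    exact mul_pos hr hw
  · exact (convex_openSegment _ _).isPreconnected.subset_connectedComponentIn hx hsegment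

theorem exists_isCoface (ε : ℤˣ) (e : O.Edge) : ∃ c, O.IsCoface ε e c := by
  by_cases h : ∃ τ, O.incidence τ e = ε
  · obtain ⟨τ, hτ⟩ := h
    exact ⟨Sum.inl τ, hτ⟩
  · obtain ⟨ν, hν⟩ := exists_voidTouches (not_exists.1 h)
    exact ⟨Sum.inr ν, hν⟩

theorem exists_dart (e : O.Edge) : ∃ η τ, O.Dart e η τ :=
  let ⟨η, hη⟩ := exists_isCoface (-1) e
  let ⟨τ, hτ⟩ := exists_isCoface 1 e
  ⟨η, τ, hη, hτ⟩

end Void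

section Coboundary

variable {R : Type*} [CommRing R] {q : ℕ} {O : OrientedComplex q} {e : O.Edge} {p : O.Cell → R}

open Classical in
theorem sum_ite_incidence_eq {ε : ℤˣ} {c : O.Cell} (hc : O.IsCoface ε e c)
    (hp : ∀ ν, p (Sum.inr ν) = 0) :
    ∑ σ : O.Facet, (if O.incidence σ e = ε then p (Sum.inl σ) else 0) = p c := by
  rcases c with τ | ν
  · rw [Fintype.sum_eq_single τ fun σ hσ => if_neg fun h => hσ (facet_eq_of_incidence_eq h hc)]
    exact if_pos hc
  · rw [hp ν]
    exact Finset.sum_eq_zero fun σ _ =>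
      if_neg fun h => not_voidTouches_of_incidence_eq h ν hc

theorem boundary_eq_sub_of_dart {η τ : O.Cell} (h : O.Dart e η τ) (hp : ∀ ν, p (Sum.inr ν) = 0) :
    O.boundary q (fun σ => p (Sum.inl σ)) e = p τ - p η := by
  classical
  rw [← sum_ite_incidence_eq h.2 hp, ← sum_ite_incidence_eq h.1 hp, ← Finset.sum_sub_distrib]
  refine Finset.sum_congr rfl fun σ _ => ?_
  by_cases hσ : O.incidence σ e = 0
  · simp [hσ]
  · obtain ⟨ε, hε⟩ := exists_unit_eq_incidence (subset_of_incidence_ne_zero hσ)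
    rcases Int.units_eq_one_or ε with rfl | rfl <;> simp [hε]

end Coboundary

section LinearProgram

variable {R : Type*} [CommRing R] [LinearOrder R] {q : ℕ} {O : OrientedComplex q}
  {d : O.DirData R} {v : O.DirVar R}

theorem DirVar.Feasible.cost_eq (hv : v.Feasible d) :
    v.cost d = ∑ e, d.c e * (v.xNat e + v.xOpp e) + ∑ τ, d.a τ * (v.potPos τ + v.potNeg τ) := by
  simp only [DirVar.cost, hv.void, mul_zero, Finset.sum_const_zero, mul_add, Finset.sum_add_distrib]
  ring

/-- The flat-norm objective `c(|z - ∂p|) + a(|p|)` of a `(q+1)`-chain `p`, to which the linear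
program reduces once its remaining variables are optimized. -/
noncomputable def flatCost (d : O.DirData R) (p : O.Chain R (q + 1)) : R :=
  weight d.c (d.z - O.boundary q p) + weight d.a p

/-- The cheapest variables of the linear program with a given potential `p` on the
facet-simplices: positive and negative parts of `p` and of `z - ∂p`. -/
noncomputable def DirVar.ofChain (d : O.DirData R) (p : O.Chain R (q + 1)) : O.DirVar R where
  pot := Sum.elim p 0
  potPos := p⁺
  potNeg := p⁻
  xNat := (d.z - O.boundary q p)⁻
  xOpp := (d.z - O.boundary q p)⁺

variable [IsStrictOrderedRing R]

theorem DirVar.Feasible.negPart_le_xNat (hv : v.Feasible d) :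
    (d.z - O.boundary q v.chain)⁻ ≤ v.xNat := by
  intro e
  obtain ⟨η, τ, hdart⟩ := exists_dart e
  have hboundary : O.boundary q v.chain e = v.pot τ - v.pot η :=
    boundary_eq_sub_of_dart hdart hv.void
  have hnat := hv.nat e η τ hdart
  refine sup_le ?_ (hv.xNat_nonneg e)
  rw [Pi.neg_apply, Pi.sub_apply, hboundary]
  linarith

theorem DirVar.Feasible.posPart_le_xOpp (hv : v.Feasible d) :
    (d.z - O.boundary q v.chain)⁺ ≤ v.xOpp := by
  intro e
  obtain ⟨η, τ, hdart⟩ := exists_dart e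
  have hboundary : O.boundary q v.chain e = v.pot τ - v.pot η :=
    boundary_eq_sub_of_dart hdart hv.void
  have hopp := hv.opp e η τ hdart
  refine sup_le ?_ (hv.xOpp_nonneg e)
  rw [Pi.sub_apply, hboundary]
  linarith

theorem DirVar.ofChain_feasible (d : O.DirData R) (p : O.Chain R (q + 1)) :
    (DirVar.ofChain d p).Feasible d where
  nat e η τ hdart := by
    have hboundary : O.boundary q p e = _ :=
      boundary_eq_sub_of_dart (p := Sum.elim p 0) hdart fun _ => rfl
    have hle : -(d.z e - O.boundary q p e) ≤ (DirVar.ofChain d p).xNat e :=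
      neg_le_negPart (d.z e - O.boundary q p e)
    rw [hboundary] at hle
    simp only [DirVar.ofChain] at hle ⊢
    linarith
  opp e η τ hdart := by
    have hboundary : O.boundary q p e = _ :=
      boundary_eq_sub_of_dart (p := Sum.elim p 0) hdart fun _ => rfl
    have hle : d.z e - O.boundary q p e ≤ (DirVar.ofChain d p).xOpp e :=
      le_posPart (d.z e - O.boundary q p e)
    rw [hboundary] at hle
    simp only [DirVar.ofChain] at hle ⊢
    linarith
  xNat_nonneg e := negPart_nonneg ((d.z - O.boundary q p) e)
  xOpp_nonneg e := posPart_nonneg ((d.z - O.boundary q p) e)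
  void _ := rfl
  potPos_nonneg τ := posPart_nonneg (p τ)
  potNeg_nonneg τ := negPart_nonneg (p τ)
  pot_eq τ := (posPart_sub_negPart (p τ)).symm

theorem DirVar.cost_ofChain (d : O.DirData R) (p : O.Chain R (q + 1)) :
    (DirVar.ofChain d p).cost d = flatCost d p := by
  have habs (a : R) : a⁻ + a⁺ = |a| := by rw [add_comm, posPart_add_negPart]
  rw [(DirVar.ofChain_feasible d p).cost_eq]
  simp only [DirVar.ofChain, flatCost, weight, Pi.posPart_apply, Pi.negPart_apply, habs,
    posPart_add_negPart]

theorem DirVar.Feasible.abs_le_xNat_add_xOpp (hv : v.Feasible d) (e : O.Edge) :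
    |(d.z - O.boundary q v.chain) e| ≤ v.xNat e + v.xOpp e := by
  rw [← posPart_add_negPart, add_comm]
  exact add_le_add (hv.negPart_le_xNat e) (hv.posPart_le_xOpp e)

theorem DirVar.Feasible.abs_chain_le (hv : v.Feasible d) (τ : O.Facet) :
    |v.chain τ| ≤ v.potPos τ + v.potNeg τ := by
  have hpos := hv.potPos_nonneg τ
  have hneg := hv.potNeg_nonneg τ
  rw [DirVar.chain, hv.pot_eq, abs_le]
  constructor <;> linarith

theorem DirVar.Feasible.flatCost_le_cost (hv : v.Feasible d) (hc : ∀ e, 0 ≤ d.c e)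
    (ha : ∀ τ, 0 ≤ d.a τ) : flatCost d v.chain ≤ v.cost d := by
  rw [hv.cost_eq]
  exact add_le_add
    (Finset.sum_le_sum fun e _ => mul_le_mul_of_nonneg_left (hv.abs_le_xNat_add_xOpp e) (hc e))
    (Finset.sum_le_sum fun τ _ => mul_le_mul_of_nonneg_left (hv.abs_chain_le τ) (ha τ))

theorem DirVar.Feasible.x_eq_of_cost_le (hv : v.Feasible d) (hc : ∀ e, 0 < d.c e)
    (ha : ∀ τ, 0 ≤ d.a τ) (hcost : v.cost d ≤ flatCost d v.chain) :
    v.x = d.z - O.boundary q v.chain := by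
  have hedge : ∀ e ∈ Finset.univ, d.c e * |(d.z - O.boundary q v.chain) e| ≤
      d.c e * (v.xNat e + v.xOpp e) := fun e _ =>
    mul_le_mul_of_nonneg_left (hv.abs_le_xNat_add_xOpp e) (hc e).le
  have hfacet : weight d.a v.chain ≤ ∑ τ, d.a τ * (v.potPos τ + v.potNeg τ) :=
    Finset.sum_le_sum fun τ _ => mul_le_mul_of_nonneg_left (hv.abs_chain_le τ) (ha τ)
  have hsum : ∑ e, d.c e * (v.xNat e + v.xOpp e) ≤ weight d.c (d.z - O.boundary q v.chain) := by
    rw [hv.cost_eq, flatCost] at hcost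
    linarith
  have htight := (Finset.sum_eq_sum_iff_of_le hedge).1 ((Finset.sum_le_sum hedge).antisymm hsum)
  funext e
  have habs := mul_left_cancel₀ (hc e).ne' (htight e (Finset.mem_univ e))
  rw [← posPart_add_negPart] at habs
  have hnat : (d.z - O.boundary q v.chain)⁻ e ≤ v.xNat e := hv.negPart_le_xNat e
  have hopp : (d.z - O.boundary q v.chain)⁺ e ≤ v.xOpp e := hv.posPart_le_xOpp e
  rw [DirVar.x, ← posPart_sub_negPart ((d.z - O.boundary q v.chain) e)]
  simp only [Pi.posPart_apply, Pi.negPart_apply] at hnat hopp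
  linarith

theorem DirVar.Optimal.isMinimalCycle (hv : v.Optimal d) (hc : ∀ e, 0 < d.c e)
    (ha : ∀ τ, 0 ≤ d.a τ) (hz : O.IsCycle q d.z) : IsMinimalCycle d v.x v.chain := by
  have hcost (p : O.Chain R (q + 1)) : v.cost d ≤ flatCost d p :=
    (hv.2 _ (DirVar.ofChain_feasible d p)).trans_eq (DirVar.cost_ofChain d p)
  have hx : v.x = d.z - O.boundary q v.chain := hv.1.x_eq_of_cost_le hc ha (hcost v.chain)
  have hboundary : O.boundary q v.chain = d.z - v.x := by rw [hx, sub_sub_cancel]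
  refine ⟨hx ▸ hz.sub (isCycle_boundary _), ⟨_, hboundary⟩, hboundary, fun x' p' _ hx' => ?_⟩
  calc weight d.c v.x + weight d.a v.chain = flatCost d v.chain := by rw [flatCost, ← hx]
    _ ≤ v.cost d := hv.1.flatCost_le_cost (fun e => (hc e).le) ha
    _ ≤ flatCost d p' := hcost p'
    _ = weight d.c x' + weight d.a p' := by rw [flatCost, hx', sub_sub_cancel]

end LinearProgram

end OrientedComplex

end FlatNorm

theorem mainTheorem9 {R : Type*} [CommRing R] [LinearOrder R] [IsStrictOrderedRing R]
    {q : ℕ} (O : FlatNorm.OrientedComplex q) (d : O.DirData R)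
    (hc : ∀ e, 0 < d.c e) (ha : ∀ τ, 0 ≤ d.a τ) (hz : O.IsCycle q d.z)
    (v : O.DirVar R) (hv : v.Optimal d) :
    (∀ ν, v.pot (Sum.inr ν) = 0) ∧
    FlatNorm.OrientedComplex.IsMinimalCycle d v.x v.chain ∧
    ((∀ τ, d.a τ = 0) → ∀ x' : O.Chain R q, O.IsCycle q x' → O.Homologous d.z x' →
      FlatNorm.OrientedComplex.weight d.c v.x ≤ FlatNorm.OrientedComplex.weight d.c x') := by
  have hmin := hv.isMinimalCycle hc ha hz
  refine ⟨hv.1.void, hmin, fun ha0 x' hx' ⟨p', hp'⟩ => ?_⟩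
  simpa only [FlatNorm.OrientedComplex.weight, ha0, zero_mul, Finset.sum_const_zero, add_zero]
    using hmin.2.2.2 x' p' hx' hp'
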